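/- Let $L$ be an infinite-dimensional separable complex Hilbert space with scalar product $(\cdot,\cdot)$ linear in the second argument, and with a conjugation $J:f\mapsto\bar f$, i.e. an antilinear involution with $(\bar f,\bar g)=(g,f)$. For a bounded operator $A$ on $L$ let $\|A\|$ be its operator norm, $A^T:=(JAJ)^*$ its transpose, and $\|A\|_2$ its Hilbert–Schmidt norm. Let a Fock representation of the canonical commutation relations over $L$ on a complex Hilbert space $\mathcal F$ be given: a dense subspace $D\subset\mathcal F$ and operators $a(f),a^\dagger(f):D\to D$, linear in $f\in L$, such that on $D$ one has $[a(f),a(g)]=0=[a^\dagger(f),a^\dagger(g)]$, $[a(f),a^\dagger(g)]=(\bar f,g)\,\mathrm{id}$ and $(a(f)\Phi,\Psi)=(\Phi,a^\dagger(\bar f)\Psi)$, together with a unit vector $\Omega\in D$ such that $a(f)\Omega=0$ for all $f$ and such that the vectors $a^\dagger(f_n)\cdots a^\dagger(f_1)\Omega$, $n\ge 0$, span a dense subspace of $\mathcal F$. The same symbol $a(f)$ denotes the closure of this operator. Let $\mathcal F^{(n)}$ be the closed span of the vectors $a^\dagger(f_n)\cdots a^\dagger(f_1)\Omega$ with $n$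 factors, let $\Phi^{(n)}$ be the orthogonal projection of $\Phi\in\mathcal F$ onto $\mathcal F^{(n)}$, and for $\alpha\ge 0$ put $D_\alpha:=\{\Phi\in\mathcal F:\sum_{n\ge0}(n+1)^{2\alpha}\|\Phi^{(n)}\|^2<\infty\}$. Let $N$ be the number operator, with powers $N^\alpha\Phi=\sum_{n\ge0} n^\alpha\Phi^{(n)}$ for $\Phi\in D_\alpha$, $\alpha>0$. Let $A$ be a Hilbert–Schmidt operator on $L$. Then there is a linear operator $\Delta(A):D_1\to\mathcal F$ such that for every complete orthonormal system $\{e_j\}_{j\ge1}$ of $L$ the partial sums $$\Delta_M(A)=\sum_{j=1}^M a(Ae_j)\,a(\bar e_j)$$ are defined on $D_1$ and converge there strongly to it: $\Delta_M(A)\Phi\to\Delta(A)\Phi$ in norm as $M\to\infty$ for every $\Phi\in D_1$. In particular, $\Delta(A)$ does not depend on the choice of $\{e_j\}$. It satisfies $$\|\Delta(A)\Phi\|^2\le\|A\|^2\,\|N\Phi\|^2+\bigl(\|A\|_2^2-\|A\|^2\bigr)\,\|N^{1/2}\Phi\|^2\qquad\text{for all }\Phi\in D_1 .$$ Furthermore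 $\Delta(A^T)=\Delta(A)$, i.e. for every complete orthonormal system the partial sums $\Delta_M(A^T)$ are also defined on $D_1$ and converge there strongly to $\Delta(A)$. -/

import Mathlib

open Filter Topology
open scoped ENNReal

noncomputable section

/-! ### Hilbert-Schmidt operators -/

section HilbertSchmidt

variable {L : Type*} [NormedAddCommGroup L] [InnerProductSpace ℂ L] [CompleteSpace L]

/-- The sum `∑ ‖A b_i‖²` along a complete orthonormal system, with values in `[0, ∞]`. -/
def hsSum {ι : Type*} (b : HilbertBasis ι ℂ L) (A : L →L[ℂ] L) : ℝ≥0∞ :=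
  ∑' i, ‖A (b i)‖ₑ ^ 2

/-- The squared Hilbert-Schmidt norm `‖A‖₂² = ∑ ‖A b_i‖²` with values in `[0, ∞]`, computed in some
complete orthonormal system; it does not depend on the system, see `hsNormSq_eq`. -/
def hsNormSq (A : L →L[ℂ] L) : ℝ≥0∞ :=
  hsSum (exists_hilbertBasis ℂ L).choose_spec.choose A

set_option linter.unusedSectionVars false in
/-- Parseval's identity. -/
theorem HilbertBasis.tsum_enorm_inner_sq {ι : Type*} (b : HilbertBasis ι ℂ L) (x : L) :
    ∑' i, ‖inner ℂ (b i) x‖ₑ ^ 2 = ‖x‖ₑ ^ 2 := by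
  have h := lp.hasSum_norm (p := 2) (by norm_num) (b.repr x)
  simp only [LinearIsometryEquiv.norm_map, ENNReal.toReal_ofNat, Real.rpow_ofNat,
    b.repr_apply_apply] at h
  have h2 := ENNReal.ofReal_tsum_of_nonneg (fun i => by positivity) h.summable
  rw [h.tsum_eq] at h2
  rw [← ofReal_norm, ← ENNReal.ofReal_pow (norm_nonneg _), h2]
  refine tsum_congr fun i => ?_
  rw [← ofReal_norm, ← ENNReal.ofReal_pow (norm_nonneg _)]

theorem hsSum_adjoint {ι κ : Type*} (b : HilbertBasis ι ℂ L) (c : HilbertBasis κ ℂ L)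
    (A : L →L[ℂ] L) : hsSum b A = hsSum c (ContinuousLinearMap.adjoint A) := by
  unfold hsSum
  simp_rw [← c.tsum_enorm_inner_sq (A _), ← b.tsum_enorm_inner_sq (ContinuousLinearMap.adjoint A _)]
  rw [ENNReal.tsum_comm]
  refine tsum_congr fun j => tsum_congr fun i => ?_
  rw [ContinuousLinearMap.adjoint_inner_right, ← ofReal_norm, ← ofReal_norm, norm_inner_symm]

theorem hsNormSq_eq {ι : Type*} (b : HilbertBasis ι ℂ L) (A : L →L[ℂ] L) :
    hsNormSq A = ∑' i, ‖A (b i)‖ₑ ^ 2 :=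
  (hsSum_adjoint _ b A).trans (hsSum_adjoint b b A).symm

/-- The class `B₂(L)` of Hilbert-Schmidt operators. -/
def IsHilbertSchmidt (A : L →L[ℂ] L) : Prop := hsNormSq A < ∞

/-- The Hilbert-Schmidt norm `‖A‖₂`. -/
def hsNorm (A : L →L[ℂ] L) : ℝ := √(hsNormSq A).toReal

end HilbertSchmidt

/-! ### Conjugations -/

/-- A conjugation `f ↦ f̄` on a complex Hilbert space: an antilinear involution with
`(f̄, ḡ) = (g, f)`. (Continuity follows from the last property.) -/
structure Conjugation (L : Type*) [NormedAddCommGroup L] [InnerProductSpace ℂ L] where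
  /-- the antilinear map -/
  conj : L →L⋆[ℂ] L
  conj_conj : ∀ f, conj (conj f) = f
  inner_conj_conj : ∀ f g, inner ℂ (conj f) (conj g) = inner ℂ g f

namespace Conjugation

variable {L : Type*} [NormedAddCommGroup L] [InnerProductSpace ℂ L]

/-- The conjugate operator `Ā = J A J`. -/
def conjOp (J : Conjugation L) (A : L →L[ℂ] L) : L →L[ℂ] L :=
  J.conj.comp (A.comp J.conj)

/-- The transpose `Aᵀ = (Ā)^*`. -/
def transpose [CompleteSpace L] (J : Conjugation L) (A : L →L[ℂ] L) : L →L[ℂ] L :=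
  ContinuousLinearMap.adjoint (J.conjOp A)

end Conjugation

/-! ### Partially defined operators -/

section PartialOperators

variable {F : Type*} [NormedAddCommGroup F] [InnerProductSpace ℂ F]

/-- The product `S T` of two partially defined operators with its natural domain
`{Φ ∈ dom T | T Φ ∈ dom S}`. -/
def LinearPMap.mulOp (S T : F →ₗ.[ℂ] F) : F →ₗ.[ℂ] F where
  domain := (S.domain.comap T.toFun).map T.domain.subtype
  toFun :=
    { toFun := fun Φ => S ⟨T ⟨Φ, by
          obtain ⟨x, _, hx⟩ := Φ.2
          exact hx ▸ x.2⟩, by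
          obtain ⟨_, x, hx, rfl⟩ := Φ
          exact hx⟩
      map_add' := fun Φ Ψ => by
        rw [← S.map_add]
        congr 1
        exact Subtype.ext (T.map_add ⟨Φ, _⟩ ⟨Ψ, _⟩)
      map_smul' := fun c Φ => by
        rw [RingHom.id_apply, ← S.map_smul]
        congr 1
        exact Subtype.ext (T.map_smul c ⟨Φ, _⟩) }

theorem LinearPMap.mem_mulOp_domain {S T : F →ₗ.[ℂ] F} {Φ : F} :
    Φ ∈ (S.mulOp T).domain ↔ ∃ h : Φ ∈ T.domain, T ⟨Φ, h⟩ ∈ S.domain := by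
  constructor
  · rintro ⟨x, hx, rfl⟩
    exact ⟨x.2, hx⟩
  · rintro ⟨h, h'⟩
    exact ⟨⟨Φ, h⟩, h', rfl⟩

theorem LinearPMap.mulOp_apply {S T : F →ₗ.[ℂ] F} {Φ : F} (h : Φ ∈ T.domain)
    (h' : T ⟨Φ, h⟩ ∈ S.domain) :
    S.mulOp T ⟨Φ, LinearPMap.mem_mulOp_domain.2 ⟨h, h'⟩⟩ = S ⟨T ⟨Φ, h⟩, h'⟩ := rfl

/-- The partially defined operators `T M` are all defined on the subspace `V` and converge there
strongly, i.e. pointwise in norm, to the operator `T'`. -/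
def ConvergesStronglyOn (T : ℕ → F →ₗ.[ℂ] F) (V : Submodule ℂ F) (T' : V →ₗ[ℂ] F) : Prop :=
  ∃ h : ∀ M, V ≤ (T M).domain,
    ∀ Φ : V, Tendsto (fun M => T M ⟨Φ, h M Φ.2⟩) atTop (𝓝 (T' Φ))

end PartialOperators

/-! ### Fock representations of the CCR -/

/-- A Fock representation, on the Hilbert space `F`, of the canonical commutation relations over
`L` with the conjugation `J`. -/
structure FockRepresentation {L : Type*} [NormedAddCommGroup L] [InnerProductSpace ℂ L]
    (J : Conjugation L) (F : Type*) [NormedAddCommGroup F] [InnerProductSpace ℂ F] where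
  /-- the common invariant domain -/
  dom : Submodule ℂ F
  dense_dom : Dense (dom : Set F)
  /-- the annihilation operators, linear in the index -/
  a : L →ₗ[ℂ] (dom →ₗ[ℂ] dom)
  /-- the creation operators, linear in the index -/
  adag : L →ₗ[ℂ] (dom →ₗ[ℂ] dom)
  a_comm : ∀ f g Φ, a f (a g Φ) - a g (a f Φ) = 0
  adag_comm : ∀ f g Φ, adag f (adag g Φ) - adag g (adag f Φ) = 0
  ccr : ∀ f g Φ, a f (adag g Φ) - adag g (a f Φ) = inner ℂ (J.conj f) g • Φ
  unitarity : ∀ (f : L) (Φ Ψ : dom),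
    inner ℂ (a f Φ : F) (Ψ : F) = inner ℂ (Φ : F) (adag (J.conj f) Ψ : F)
  /-- the vacuum -/
  vac : dom
  norm_vac : ‖(vac : F)‖ = 1
  a_vac : ∀ f, a f vac = 0
  /-- the vectors `a†(f_n) ⋯ a†(f_1) Ω` span a dense subspace -/
  cyclic : Dense (Submodule.span ℂ (Set.range fun l : List L =>
    ((l.foldr (fun f Φ => adag f Φ) vac : dom) : F)) : Set F)

namespace FockRepresentation

variable {L : Type*} [NormedAddCommGroup L] [InnerProductSpace ℂ L] {J : Conjugation L}
variable {F : Type*} [NormedAddCommGroup F] [InnerProductSpace ℂ F]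

/-- The vector `a†(f_n) ⋯ a†(f_1) Ω` for the list `[f_n, …, f_1]`. -/
def monomial (R : FockRepresentation J F) (l : List L) : R.dom :=
  l.foldr (fun f Φ => R.adag f Φ) R.vac

/-- The algebraic `n`-particle space, the span of the `a†(f_n) ⋯ a†(f_1) Ω`. -/
def sector₀ (R : FockRepresentation J F) (n : ℕ) : Submodule ℂ F :=
  Submodule.span ℂ {Φ | ∃ l : List L, l.length = n ∧ Φ = (R.monomial l : F)}

/-- The `n`-particle space, the closure of the algebraic one. -/
def sector (R : FockRepresentation J F) (n : ℕ) : Submodule ℂ F :=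
  (R.sector₀ n).topologicalClosure

/-- The annihilation operator `a(f)` as an operator in `F` with domain `dom`. -/
def ann₀ (R : FockRepresentation J F) (f : L) : F →ₗ.[ℂ] F where
  domain := R.dom
  toFun := R.dom.subtype.comp (R.a f)

/-- The annihilation operator `a(f)`, extended by closure; see `ann₀_isClosable`. -/
def ann (R : FockRepresentation J F) (f : L) : F →ₗ.[ℂ] F :=
  (R.ann₀ f).closure

/-- The partial sums `Δ_M(A) = ∑_{j ≤ M} a(A e_j) a(ē_j)`, on their natural domain. -/
def deltaPartial (R : FockRepresentation J F) (e : HilbertBasis ℕ ℂ L) (A : L →L[ℂ] L) (M : ℕ) :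
    F →ₗ.[ℂ] F :=
  ∑ j ∈ Finset.range M, (R.ann (A (e j))).mulOp (R.ann (J.conj (e j)))

theorem ann₀_isClosable [CompleteSpace F] (R : FockRepresentation J F) (f : L) :
    (R.ann₀ f).IsClosable := by
  let T : F →ₗ.[ℂ] F := ⟨R.dom, R.dom.subtype.comp (R.adag (J.conj f))⟩
  have hT : Dense (T.domain : Set F) := R.dense_dom
  have h : T.IsFormalAdjoint (R.ann₀ f) := fun Φ Ψ => by
    have := R.unitarity f Ψ Φ
    rw [← inner_conj_symm, ← inner_conj_symm (Ψ : F)] at this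
    exact ((starRingEnd ℂ).injective this).symm
  exact (LinearPMap.adjoint_isClosed hT).isClosable.leIsClosable (h.le_adjoint hT)

theorem a_mem_span (R : FockRepresentation J F) (f g : L) (l : List L) :
    R.a f (R.monomial (g :: l)) ∈
      Submodule.span ℂ {Φ | ∃ k : List L, k.length = l.length ∧ Φ = R.monomial k} := by
  induction l generalizing g with
  | nil =>
    have h := R.ccr f g R.vac
    rw [R.a_vac, map_zero, sub_zero] at h
    exact h ▸ Submodule.smul_mem _ _ (Submodule.subset_span ⟨[], rfl, rfl⟩)
  | cons g' l ih =>
    have h := sub_eq_iff_eq_add.1 (R.ccr f g (R.monomial (g' :: l)))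
    have h2 : R.a f (R.monomial (g :: g' :: l)) = R.a f (R.adag g (R.monomial (g' :: l))) := rfl
    rw [h2, h]
    refine Submodule.add_mem _ (Submodule.smul_mem _ _ (Submodule.subset_span ⟨_, rfl, rfl⟩)) ?_
    have := Submodule.mem_map_of_mem (f := R.adag g) (ih g')
    rw [Submodule.map_span] at this
    refine Submodule.span_mono ?_ this
    rintro _ ⟨_, ⟨k, hk, rfl⟩, rfl⟩
    exact ⟨g :: k, by simp [hk], rfl⟩

theorem inner_monomial_eq_zero (R : FockRepresentation J F) (l : List L) (n : ℕ) (hn : n < l.length)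
    (Φ : R.dom)
    (hΦ : Φ ∈ Submodule.span ℂ {Φ | ∃ k : List L, k.length = n ∧ Φ = R.monomial k}) :
    inner ℂ (Φ : F) (R.monomial l : F) = 0 := by
  induction l generalizing n Φ with
  | nil => simp at hn
  | cons g l ih =>
    have h := R.unitarity (J.conj g) Φ (R.monomial l)
    rw [J.conj_conj] at h
    refine h.symm.trans ?_
    induction hΦ using Submodule.span_induction with
    | zero => simp
    | add x y _ _ hx hy =>
      rw [map_add, Submodule.coe_add, inner_add_left,
        hx (by simpa using R.unitarity (J.conj g) x (R.monomial l)|>.trans (by rw [J.conj_conj])),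
        hy (by simpa using R.unitarity (J.conj g) y (R.monomial l)|>.trans (by rw [J.conj_conj])),
        add_zero]
    | smul c x _ hx =>
      rw [map_smul, Submodule.coe_smul, inner_smul_left,
        hx (by simpa using R.unitarity (J.conj g) x (R.monomial l)|>.trans (by rw [J.conj_conj])),
        mul_zero]
    | mem x hx =>
      obtain ⟨k, rfl, rfl⟩ := hx
      cases k with
      | nil =>
        have : R.a (J.conj g) (R.monomial []) = 0 := R.a_vac _
        rw [this, Submodule.coe_zero, inner_zero_left]
      | cons g' k =>
        exact ih k.length (by simpa using hn) _ (R.a_mem_span _ _ _)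

/-- The `n`-particle spaces are pairwise orthogonal. -/
theorem sector_isOrtho (R : FockRepresentation J F) {m n : ℕ} (h : m ≠ n) :
    R.sector m ⟂ R.sector n := by
  wlog hmn : m < n generalizing m n
  · exact (this h.symm (by omega)).symm
  unfold sector
  rw [Submodule.isOrtho_iff_le, Submodule.orthogonal_closure]
  refine Submodule.topologicalClosure_minimal _ ?_ (Submodule.isClosed_orthogonal _)
  rw [← Submodule.isOrtho_iff_le]
  unfold sector₀
  rw [Submodule.isOrtho_span]
  rintro _ ⟨k, hk, rfl⟩ _ ⟨l, rfl, rfl⟩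
  exact R.inner_monomial_eq_zero l m hmn _ (Submodule.subset_span ⟨k, hk, rfl⟩)

variable [CompleteSpace F]

/-- The `n`-particle component `Φ⁽ⁿ⁾` of `Φ`. -/
def component (R : FockRepresentation J F) (n : ℕ) : F →L[ℂ] F :=
  haveI : CompleteSpace (R.sector n) :=
    inferInstanceAs (CompleteSpace (R.sector₀ n).topologicalClosure)
  (R.sector n).starProjection

/-- The subspace `D_α` of all `Φ` with `∑ (n+1)^{2α} ‖Φ⁽ⁿ⁾‖² < ∞`. -/
def D (R : FockRepresentation J F) (α : ℝ) : Submodule ℂ F where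
  carrier := {Φ | Summable fun n : ℕ => ((n : ℝ) + 1) ^ (2 * α) * ‖R.component n Φ‖ ^ 2}
  zero_mem' := by simp
  add_mem' := fun {Φ Ψ} hΦ hΨ => by
    refine Summable.of_nonneg_of_le (fun n => by positivity) (fun n => ?_)
      ((hΦ.add hΨ).mul_left 2)
    have h1 : ‖R.component n (Φ + Ψ)‖ ^ 2
        ≤ 2 * (‖R.component n Φ‖ ^ 2 + ‖R.component n Ψ‖ ^ 2) := by
      rw [map_add]
      have := norm_add_le (R.component n Φ) (R.component n Ψ)
      nlinarith [norm_nonneg (R.component n Φ + R.component n Ψ),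
        sq_nonneg (‖R.component n Φ‖ - ‖R.component n Ψ‖)]
    have h2 : (0 : ℝ) ≤ ((n : ℝ) + 1) ^ (2 * α) := by positivity
    nlinarith [mul_le_mul_of_nonneg_left h1 h2]
  smul_mem' := fun c Φ hΦ => by
    refine (hΦ.mul_left (‖c‖ ^ 2)).congr fun n => ?_
    rw [map_smul, norm_smul]
    ring

/-- The powers of the number operator, `N^α Φ = ∑ n^α Φ⁽ⁿ⁾` for `Φ ∈ D_α`; the series converges
there, see `hasSum_numberPow`. -/
def numberPow (R : FockRepresentation J F) (α : ℝ) (Φ : F) : F :=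
  ∑' n : ℕ, ((n : ℝ) ^ α : ℝ) • R.component n Φ

theorem hasSum_numberPow (R : FockRepresentation J F) {α : ℝ} (hα : 0 ≤ α) {Φ : F}
    (hΦ : Φ ∈ R.D α) :
    HasSum (fun n : ℕ => ((n : ℝ) ^ α : ℝ) • R.component n Φ) (R.numberPow α Φ) := by
  refine Summable.hasSum ?_
  have hV : OrthogonalFamily ℂ (fun n => R.sector n) fun n => (R.sector n).subtypeₗᵢ :=
    fun m n h x y => (R.sector_isOrtho h).inner_eq x.2 y.2
  have hmem : ∀ n, R.component n Φ ∈ R.sector n := fun n => by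
    have : CompleteSpace (R.sector n) :=
      inferInstanceAs (CompleteSpace (R.sector₀ n).topologicalClosure)
    exact Submodule.starProjection_apply_mem _ _
  have key := (hV.summable_iff_norm_sq_summable
    (fun n => (((n : ℝ) ^ α : ℝ) : ℂ) • (⟨R.component n Φ, hmem n⟩ : R.sector n))).2 ?_
  · exact key.congr fun n => by simp
  refine Summable.of_nonneg_of_le (fun n => by positivity) (fun n => ?_) hΦ
  have h0 : (0 : ℝ) ≤ n := n.cast_nonneg
  have h1 : ((n : ℝ) ^ α) ^ 2 ≤ ((n : ℝ) + 1) ^ (2 * α) := by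
    rw [← Real.rpow_mul_natCast h0]
    calc (n : ℝ) ^ (α * (2 : ℕ)) ≤ ((n : ℝ) + 1) ^ (α * (2 : ℕ)) :=
          Real.rpow_le_rpow h0 (by linarith) (by positivity)
      _ = _ := by rw [mul_comm, Nat.cast_ofNat]
  rw [norm_smul, mul_pow, Complex.norm_real, Real.norm_eq_abs, sq_abs]
  exact mul_le_mul_of_nonneg_right h1 (by positivity)

/-- `Δ` is the operator `Δ(A)` on `D_1`: for every complete orthonormal system, the partial sums
`Δ_M(A)` are defined on `D_1` and converge there strongly to `Δ`. -/
def IsDelta (R : FockRepresentation J F) (A : L →L[ℂ] L) (Δ : R.D 1 →ₗ[ℂ] F) : Prop :=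
  ∀ e : HilbertBasis ℕ ℂ L, ConvergesStronglyOn (R.deltaPartial e A) (R.D 1) Δ

end FockRepresentation

end

/-! On an algebraic n-particle vector the annihilators have finite rank in their index: a(g)Φ = ∑
(ḡ, h_i) v_i with ∑ a†(h_i) v_i = nΦ. Orthonormal v_i give ∑ ‖h_i‖² = n‖Φ‖², and Bessel's inequality
then bounds ∑_k ‖a(B e_k)Φ‖² by ‖B‖² n‖Φ‖² (`sum_norm_a_sq_le`). The CCR bound ‖∑ a(f_j)Ψ_j‖² by ∑∑
‖a(f_k)Ψ_j‖² + ∑ ‖f_k‖² ∑ ‖Ψ_j‖² (`norm_sum_a_sq_le`). For f_j = B e_j and Ψ_j = a(ē_j)Φ, which has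
n-1 particles, the result is (‖B‖² n(n-1) + ‖B‖₂² n)‖Φ‖², the claimed bound on one sector
(`norm_sum_a_a_sq_le`).

Sectors are orthogonal and Δ_M removes exactly two particles, so the bound adds up over finitely
many sectors, uniformly in M and in the orthonormal system. On such vectors convergence reduces to
Parseval's identity; the limit has coefficients (k̄, A h), free of the system, and is the same for
Aᵀ because annihilators commute (`exists_tendsto_deltaSum_nSpace`).

Each Φ in D_1 is a limit of algebraic vectors along which N^{1/2} and N converge too
(`mem_closure_weightGraph`). The uniform bound carries the domains, the limits and the estimate over
to D_1. -/

noncomputable section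

/-! ### Conjugations and Gram sums -/

namespace Conjugation

variable {L : Type*} [NormedAddCommGroup L] [InnerProductSpace ℂ L] (J : Conjugation L)

theorem norm_conj (f : L) : ‖J.conj f‖ = ‖f‖ := by
  have h := J.inner_conj_conj f f
  rw [inner_self_eq_norm_sq_to_K, inner_self_eq_norm_sq_to_K] at h
  have h2 : ‖J.conj f‖ ^ 2 = ‖f‖ ^ 2 := by exact_mod_cast h
  exact (pow_left_inj₀ (norm_nonneg _) (norm_nonneg _) two_ne_zero).1 h2

theorem inner_conj_left (f g : L) : inner ℂ (J.conj f) g = inner ℂ (J.conj g) f := by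
  rw [← J.inner_conj_conj, J.conj_conj]

theorem orthonormal_conj {ι : Type*} {e : ι → L} (he : Orthonormal ℂ e) :
    Orthonormal ℂ fun i => J.conj (e i) := by
  refine ⟨fun i => by rw [J.norm_conj, he.1 i], fun i j hij => ?_⟩
  exact (J.inner_conj_conj _ _).trans (he.2 hij.symm)

end Conjugation

theorem sum_re_inner_nonneg {E κ : Type*} [NormedAddCommGroup E] [InnerProductSpace ℂ E]
    (s : Finset κ) (x : κ → E) : 0 ≤ ∑ j ∈ s, ∑ k ∈ s, RCLike.re (inner ℂ (x j) (x k)) := by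
  have h := inner_self_nonneg (𝕜 := ℂ) (x := ∑ j ∈ s, x j)
  rw [sum_inner, map_sum] at h
  simpa only [inner_sum, map_sum] using h

/-! ### Estimates on the algebraic n-particle spaces -/

namespace FockRepresentation

variable {L : Type*} [NormedAddCommGroup L] [InnerProductSpace ℂ L] {J : Conjugation L}
variable {F : Type*} [NormedAddCommGroup F] [InnerProductSpace ℂ F]

/-- The algebraic `n`-particle space as a subspace of the common domain. -/
def nSpace (R : FockRepresentation J F) (n : ℕ) : Submodule ℂ R.dom :=
  Submodule.span ℂ {Φ | ∃ l : List L, l.length = n ∧ Φ = R.monomial l}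

/-- The algebraic `(n-1)`-particle space, understood as zero for `n = 0`. -/
def below (R : FockRepresentation J F) : ℕ → Submodule ℂ R.dom
  | 0 => ⊥
  | n + 1 => R.nSpace n

theorem sector₀_eq_map (R : FockRepresentation J F) (n : ℕ) :
    R.sector₀ n = (R.nSpace n).map R.dom.subtype := by
  rw [nSpace, Submodule.map_span]
  unfold sector₀
  congr 1
  ext x
  constructor
  · rintro ⟨l, hl, rfl⟩
    exact ⟨_, ⟨l, hl, rfl⟩, rfl⟩
  · rintro ⟨_, ⟨l, hl, rfl⟩, rfl⟩
    exact ⟨l, hl, rfl⟩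

theorem adag_mem (R : FockRepresentation J F) (f : L) {n : ℕ} {Φ : R.dom} (hΦ : Φ ∈ R.nSpace n) :
    R.adag f Φ ∈ R.nSpace (n + 1) := by
  have := Submodule.mem_map_of_mem (f := R.adag f) hΦ
  rw [nSpace, Submodule.map_span] at this
  refine Submodule.span_mono ?_ this
  rintro _ ⟨_, ⟨k, hk, rfl⟩, rfl⟩
  exact ⟨f :: k, by simp [hk], rfl⟩

theorem adag_mem_of_below (R : FockRepresentation J F) (f : L) {n : ℕ} {Φ : R.dom}
    (hΦ : Φ ∈ R.below n) : R.adag f Φ ∈ R.nSpace n := by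
  cases n with
  | zero =>
    rw [show Φ = 0 from (Submodule.mem_bot ℂ).1 hΦ, map_zero]
    exact Submodule.zero_mem _
  | succ n => exact R.adag_mem f hΦ

theorem inner_a_right (R : FockRepresentation J F) (f : L) (Φ Ψ : R.dom) :
    inner ℂ Φ (R.a f Ψ) = inner ℂ (R.adag (J.conj f) Φ) Ψ := by
  rw [← inner_conj_symm, ← inner_conj_symm (R.adag _ _)]
  exact congrArg _ (R.unitarity f Ψ Φ)

theorem inner_adag_right (R : FockRepresentation J F) (f : L) (Φ Ψ : R.dom) :
    inner ℂ Φ (R.adag f Ψ) = inner ℂ (R.a (J.conj f) Φ) Ψ := by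
  have := R.unitarity (J.conj f) Φ Ψ
  rw [J.conj_conj] at this
  exact this.symm

theorem a_adag (R : FockRepresentation J F) (f g : L) (Φ : R.dom) :
    R.a f (R.adag g Φ) = inner ℂ (J.conj f) g • Φ + R.adag g (R.a f Φ) :=
  sub_eq_iff_eq_add.1 (R.ccr f g Φ)

/-- On a vector with `n` particles, the annihilation operators have finite rank in the index. -/
theorem exists_a_eq_sum (R : FockRepresentation J F) {n : ℕ} {Φ : R.dom} (hΦ : Φ ∈ R.nSpace n) :
    ∃ (ι : Type) (_ : Fintype ι) (h : ι → L) (v : ι → R.dom), (∀ i, v i ∈ R.below n) ∧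
      (∀ g, R.a g Φ = ∑ i, inner ℂ (J.conj g) (h i) • v i) ∧
      ∑ i, R.adag (h i) (v i) = (n : ℂ) • Φ := by
  induction hΦ using Submodule.span_induction with
  | zero => exact ⟨Empty, inferInstance, Empty.elim, Empty.elim, by simp, by simp, by simp⟩
  | add x y _ _ hx hy =>
    obtain ⟨ι, _, h, v, h1, h2, h3⟩ := hx
    obtain ⟨κ, _, h', v', h1', h2', h3'⟩ := hy
    refine ⟨ι ⊕ κ, inferInstance, Sum.elim h h', Sum.elim v v', ?_, fun g => ?_, ?_⟩
    · rintro (i | i)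
      exacts [h1 i, h1' i]
    · simp [h2, h2']
    · simp [h3, h3']
  | smul c x _ hx =>
    obtain ⟨ι, _, h, v, h1, h2, h3⟩ := hx
    refine ⟨ι, inferInstance, h, fun i => c • v i, fun i => Submodule.smul_mem _ _ (h1 i),
      fun g => ?_, ?_⟩
    · simp only [map_smul, h2, Finset.smul_sum, smul_comm c]
    · simp only [map_smul, ← Finset.smul_sum, h3, smul_comm c]
  | mem x hx =>
    obtain ⟨l, rfl, rfl⟩ := hx
    induction l with
    | nil =>
      exact ⟨Empty, inferInstance, Empty.elim, Empty.elim, by simp,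
        by simpa [monomial] using fun g => R.a_vac g, by simp⟩
    | cons f l ih =>
      obtain ⟨ι, _, h, v, h1, h2, h3⟩ := ih
      have hcons : R.monomial (f :: l) = R.adag f (R.monomial l) := rfl
      -- Moving a(g) past a†(f) adds one term with index f and puts a†(f) in front of the old ones.
      refine ⟨Option ι, inferInstance, fun i => i.elim f h,
        fun i => i.elim (R.monomial l) fun i => R.adag f (v i), ?_, fun g => ?_, ?_⟩
      · rintro (_ | i)
        · exact Submodule.subset_span ⟨l, rfl, rfl⟩
        · exact R.adag_mem_of_below f (h1 i)
      · rw [hcons, a_adag, h2, map_sum, Fintype.sum_option]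
        simp
      · rw [Fintype.sum_option]
        have hc : ∀ i, R.adag (h i) (R.adag f (v i)) = R.adag f (R.adag (h i) (v i)) :=
          fun i => sub_eq_zero.1 (R.adag_comm _ _ _)
        simp only [Option.elim, hc]
        rw [← map_sum, h3, hcons, map_smul]
        push_cast [List.length_cons]
        rw [add_smul, one_smul, add_comm]

/-- Both identities depend only on the tensor ∑ h_i ⊗ v_i, so the v_i may be re-expanded in an
orthonormal basis of their span. Then ‖a(g)Φ‖² becomes a sum of squares. -/
theorem exists_orthonormal_a_eq_sum (R : FockRepresentation J F) {n : ℕ} {Φ : R.dom}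
    (hΦ : Φ ∈ R.nSpace n) :
    ∃ (ι : Type) (_ : Fintype ι) (h : ι → L) (v : ι → R.dom), Orthonormal ℂ v ∧
      (∀ i, v i ∈ R.below n) ∧
      (∀ g, R.a g Φ = ∑ i, inner ℂ (J.conj g) (h i) • v i) ∧
      ∑ i, R.adag (h i) (v i) = (n : ℂ) • Φ := by
  obtain ⟨ι, _, h, v, h1, h2, h3⟩ := R.exists_a_eq_sum hΦ
  let U : Submodule ℂ R.dom := Submodule.span ℂ (Set.range v)
  have : FiniteDimensional ℂ U := FiniteDimensional.span_of_finite ℂ (Set.finite_range v)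
  let u := stdOrthonormalBasis ℂ U
  have hv : ∀ i, v i = ∑ k, inner ℂ (u k : R.dom) (v i) • (u k : R.dom) := fun i => by
    have := congrArg U.subtype (u.sum_repr' ⟨v i, Submodule.subset_span ⟨i, rfl⟩⟩)
    rw [map_sum] at this
    exact this.symm
  refine ⟨_, inferInstance, fun k => ∑ i, inner ℂ (u k : R.dom) (v i) • h i,
    fun k => (u k : R.dom), u.orthonormal.comp_linearIsometry U.subtypeₗᵢ, fun k => ?_,
    fun g => ?_, ?_⟩
  · exact Submodule.span_le.2 (by rintro _ ⟨i, rfl⟩; exact h1 i) (u k).2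
  · simp only [h2, inner_sum, Finset.sum_smul, inner_smul_right]
    rw [Finset.sum_comm]
    refine Finset.sum_congr rfl fun i _ => ?_
    conv_lhs => rw [hv i, Finset.smul_sum]
    refine Finset.sum_congr rfl fun k _ => ?_
    rw [smul_smul, mul_comm]
  · rw [← h3]
    simp only [map_sum, map_smul, LinearMap.sum_apply, LinearMap.smul_apply]
    rw [Finset.sum_comm]
    refine Finset.sum_congr rfl fun i _ => ?_
    conv_rhs => rw [hv i, map_sum]
    simp only [map_smul]

theorem a_mem_below (R : FockRepresentation J F) (f : L) {n : ℕ} {Φ : R.dom}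
    (hΦ : Φ ∈ R.nSpace n) : R.a f Φ ∈ R.below n := by
  obtain ⟨ι, _, h, v, h1, h2, -⟩ := R.exists_a_eq_sum hΦ
  rw [h2]
  exact Submodule.sum_mem _ fun i _ => Submodule.smul_mem _ _ (h1 i)

/-- For an orthonormal system `e`, the sum of `‖a(B e_k) Φ‖²` is at most `‖B‖² n ‖Φ‖²` on the
`n`-particle space. -/
theorem sum_norm_a_sq_le [CompleteSpace L] (R : FockRepresentation J F) {n : ℕ} {Φ : R.dom}
    (hΦ : Φ ∈ R.nSpace n) {κ : Type*} {e : κ → L} (he : Orthonormal ℂ e) (B : L →L[ℂ] L)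
    (s : Finset κ) : ∑ k ∈ s, ‖R.a (B (e k)) Φ‖ ^ 2 ≤ ‖B‖ ^ 2 * (n * ‖Φ‖ ^ 2) := by
  obtain ⟨ι, _, h, v, hv, -, h2, h3⟩ := R.exists_orthonormal_a_eq_sum hΦ
  -- Pair ∑ a†(h_i) v_i = nΦ with Φ: the coefficient of a(h̄_i)Φ along v_i is ‖h_i‖².
  have hn : (n : ℝ) * ‖Φ‖ ^ 2 = ∑ i, ‖h i‖ ^ 2 := by
    have h4 : inner ℂ Φ ((n : ℂ) • Φ) = ∑ i, ((‖h i‖ : ℂ)) ^ 2 := by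
      rw [← h3, inner_sum]
      refine Finset.sum_congr rfl fun i _ => ?_
      rw [inner_adag_right, h2, J.conj_conj, hv.inner_left_fintype]
      rw [inner_self_eq_norm_sq_to_K]
      simp
    rw [inner_smul_right, inner_self_eq_norm_sq_to_K] at h4
    apply Complex.ofReal_injective
    push_cast
    exact h4
  have hsq : ∀ g, ‖R.a g Φ‖ ^ 2 = ∑ i, ‖inner ℂ (J.conj g) (h i)‖ ^ 2 := fun g => by
    have h4 := hv.inner_sum (fun i => inner ℂ (J.conj g) (h i))
      (fun i => inner ℂ (J.conj g) (h i)) Finset.univ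
    rw [← h2, inner_self_eq_norm_sq_to_K] at h4
    simp only [RCLike.conj_mul] at h4
    exact_mod_cast h4
  simp only [hsq, hn]
  rw [Finset.sum_comm, Finset.mul_sum]
  refine Finset.sum_le_sum fun i _ => ?_
  -- Moving B to the other side leaves coefficients of B*h̄_i along the e_k, to which Bessel's
  -- inequality applies.
  have h5 : ∀ k, ‖inner ℂ (J.conj (B (e k))) (h i)‖
      = ‖inner ℂ (e k) (ContinuousLinearMap.adjoint B (J.conj (h i)))‖ := fun k => by
    rw [ContinuousLinearMap.adjoint_inner_right, J.inner_conj_left, norm_inner_symm]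
  simp only [h5]
  refine (he.sum_inner_products_le _).trans ?_
  rw [← mul_pow]
  refine pow_le_pow_left₀ (norm_nonneg _) ?_ 2
  refine (ContinuousLinearMap.le_opNorm _ _).trans ?_
  rw [LinearIsometryEquiv.norm_map, J.norm_conj]

theorem sum_norm_a_conj_sq_le [CompleteSpace L] (R : FockRepresentation J F) {n : ℕ} {Φ : R.dom}
    (hΦ : Φ ∈ R.nSpace n) {κ : Type*} {e : κ → L} (he : Orthonormal ℂ e)
    (s : Finset κ) : ∑ k ∈ s, ‖R.a (J.conj (e k)) Φ‖ ^ 2 ≤ n * ‖Φ‖ ^ 2 := by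
  refine (R.sum_norm_a_sq_le hΦ (J.orthonormal_conj he) (ContinuousLinearMap.id ℂ L) s).trans ?_
  have := ContinuousLinearMap.norm_id_le (𝕜 := ℂ) (E := L)
  have h2 : ‖ContinuousLinearMap.id ℂ L‖ ^ 2 ≤ 1 := by
    simpa using pow_le_pow_left₀ (norm_nonneg _) this 2
  exact mul_le_of_le_one_left (by positivity) h2

theorem norm_a_sq_le [CompleteSpace L] (R : FockRepresentation J F) {n : ℕ} {Φ : R.dom}
    (hΦ : Φ ∈ R.nSpace n) (f : L) : ‖R.a f Φ‖ ^ 2 ≤ ‖f‖ ^ 2 * (n * ‖Φ‖ ^ 2) := by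
  rcases eq_or_ne f 0 with rfl | hf
  · simp
  have hf' : (‖f‖ : ℂ) ≠ 0 := by simpa using hf
  have he : Orthonormal ℂ fun _ : Unit => J.conj ((‖f‖ : ℂ)⁻¹ • f) :=
    ⟨fun _ => by simp [J.norm_conj, norm_smul, hf], fun i j hij => (hij rfl).elim⟩
  have h := R.sum_norm_a_conj_sq_le hΦ he Finset.univ
  simp only [J.conj_conj, map_smul, LinearMap.smul_apply, norm_smul, Finset.univ_unique,
    Finset.sum_singleton] at h
  rw [norm_inv, Complex.norm_real, norm_norm, mul_pow, inv_pow, inv_mul_le_iff₀] at h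
  · exact h
  · have := norm_pos_iff.2 hf
    positivity

theorem norm_adag_sq (R : FockRepresentation J F) (f : L) (Φ : R.dom) :
    ‖R.adag (J.conj f) Φ‖ ^ 2 = ‖R.a f Φ‖ ^ 2 + ‖f‖ ^ 2 * ‖Φ‖ ^ 2 := by
  have h : inner ℂ (R.adag (J.conj f) Φ) (R.adag (J.conj f) Φ)
      = inner ℂ (R.a f Φ) (R.a f Φ) + inner ℂ f f * inner ℂ Φ Φ := by
    rw [← inner_a_right, a_adag, inner_add_right, inner_smul_right, inner_adag_right,
      J.conj_conj, J.inner_conj_conj, add_comm]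
  simp only [inner_self_eq_norm_sq_to_K] at h
  exact_mod_cast h

/-- The CCR turn (a(f_j)Ψ_j, a(f_k)Ψ_k) into (a†(f̄_k)Ψ_j, a†(f̄_j)Ψ_k) minus a Gram term whose
double sum is nonnegative and can be dropped. Interchanging the indices allows Cauchy–Schwarz term
by term without mixing different j in the index and the vector. -/
theorem norm_sum_a_sq_le (R : FockRepresentation J F) {κ : Type*} (s : Finset κ) (f : κ → L)
    (Ψ : κ → R.dom) :
    ‖∑ j ∈ s, R.a (f j) (Ψ j)‖ ^ 2 ≤ ∑ j ∈ s, ∑ k ∈ s, ‖R.a (f k) (Ψ j)‖ ^ 2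
      + (∑ k ∈ s, ‖f k‖ ^ 2) * ∑ j ∈ s, ‖Ψ j‖ ^ 2 := by
  have hinner : ∀ j k, inner ℂ (R.a (f j) (Ψ j)) (R.a (f k) (Ψ k))
      = inner ℂ (R.adag (J.conj (f k)) (Ψ j)) (R.adag (J.conj (f j)) (Ψ k))
        - inner ℂ (f j) (f k) * inner ℂ (Ψ j) (Ψ k) := fun j k => by
    rw [← R.inner_a_right (f k), a_adag, inner_add_right, inner_smul_right, inner_adag_right,
      J.conj_conj, J.inner_conj_conj]
    ring
  -- This is the squared norm of ∑ f_j ⊗ Ψ_j.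
  have hgram : 0 ≤ ∑ j ∈ s, ∑ k ∈ s,
      RCLike.re (inner ℂ (f j) (f k) * inner ℂ (Ψ j) (Ψ k)) := by
    simpa only [TensorProduct.inner_tmul] using
      sum_re_inner_nonneg s fun j => f j ⊗ₜ[ℂ] Ψ j
  have hcs : ∀ j k, RCLike.re
      (inner ℂ (R.adag (J.conj (f k)) (Ψ j)) (R.adag (J.conj (f j)) (Ψ k)))
      ≤ (‖R.adag (J.conj (f k)) (Ψ j)‖ ^ 2 + ‖R.adag (J.conj (f j)) (Ψ k)‖ ^ 2) / 2 := fun j k => by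
    refine (re_inner_le_norm _ _).trans ?_
    nlinarith [sq_nonneg (‖R.adag (J.conj (f k)) (Ψ j)‖ - ‖R.adag (J.conj (f j)) (Ψ k)‖)]
  have hlhs : ‖∑ j ∈ s, R.a (f j) (Ψ j)‖ ^ 2
      = ∑ j ∈ s, ∑ k ∈ s, RCLike.re (inner ℂ (R.a (f j) (Ψ j)) (R.a (f k) (Ψ k))) := by
    rw [← inner_self_eq_norm_sq (𝕜 := ℂ)]
    simp only [sum_inner, inner_sum, map_sum]
    exact Finset.sum_comm
  calc ‖∑ j ∈ s, R.a (f j) (Ψ j)‖ ^ 2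
      ≤ ∑ j ∈ s, ∑ k ∈ s,
        (‖R.adag (J.conj (f k)) (Ψ j)‖ ^ 2 + ‖R.adag (J.conj (f j)) (Ψ k)‖ ^ 2) / 2 := by
        rw [hlhs]
        simp only [hinner, map_sub, Finset.sum_sub_distrib]
        have := Finset.sum_le_sum fun j (_ : j ∈ s) => Finset.sum_le_sum fun k (_ : k ∈ s) =>
          hcs j k
        linarith
    _ = ∑ j ∈ s, ∑ k ∈ s, ‖R.adag (J.conj (f k)) (Ψ j)‖ ^ 2 := by
        simp only [add_div, Finset.sum_add_distrib]
        rw [Finset.sum_comm (f := fun j k => ‖R.adag (J.conj (f j)) (Ψ k)‖ ^ 2 / 2)]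
        simp only [← Finset.sum_add_distrib, add_halves]
    _ = _ := by
        simp only [norm_adag_sq, Finset.sum_add_distrib]
        rw [Finset.sum_mul_sum, Finset.sum_comm (f := fun j k => ‖f k‖ ^ 2 * ‖Ψ j‖ ^ 2)]

theorem below_eq_of_mem (R : FockRepresentation J F) {n : ℕ} {Φ : R.dom} (hΦ : Φ ∈ R.below n) :
    Φ = 0 ∨ ∃ k, n = k + 1 ∧ Φ ∈ R.nSpace k := by
  cases n with
  | zero => exact .inl hΦ
  | succ n => exact .inr ⟨n, rfl, hΦ⟩

/-- A crude bound, n² in place of n(n-1); it serves only to place D_1 in the domain of each product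
of closed annihilators. -/
theorem norm_a_a_sq_le [CompleteSpace L] (R : FockRepresentation J F) {n : ℕ} {Φ : R.dom}
    (hΦ : Φ ∈ R.nSpace n) (f g : L) :
    ‖R.a f (R.a g Φ)‖ ^ 2 ≤ (‖f‖ ^ 2 * ‖g‖ ^ 2) * n ^ 2 * ‖Φ‖ ^ 2 := by
  rcases R.below_eq_of_mem (R.a_mem_below g hΦ) with h | ⟨k, rfl, h⟩
  · rw [h, map_zero]
    rw [norm_zero, zero_pow two_ne_zero]
    positivity
  refine (R.norm_a_sq_le h f).trans ?_
  have h2 := R.norm_a_sq_le hΦ g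
  calc ‖f‖ ^ 2 * (k * ‖R.a g Φ‖ ^ 2)
      ≤ ‖f‖ ^ 2 * ((k + 1 : ℕ) * (‖g‖ ^ 2 * ((k + 1 : ℕ) * ‖Φ‖ ^ 2))) := by
        gcongr
        omega
    _ = _ := by ring

theorem norm_sum_a_a_sq_le [CompleteSpace L] (R : FockRepresentation J F) {n : ℕ} {Φ : R.dom}
    (hΦ : Φ ∈ R.nSpace n) {κ : Type*} {e : κ → L} (he : Orthonormal ℂ e) (B : L →L[ℂ] L)
    {H : ℝ} (s : Finset κ) (hH : ∑ k ∈ s, ‖B (e k)‖ ^ 2 ≤ H) :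
    ‖∑ j ∈ s, R.a (B (e j)) (R.a (J.conj (e j)) Φ)‖ ^ 2
      ≤ (‖B‖ ^ 2 * n ^ 2 + (H - ‖B‖ ^ 2) * n) * ‖Φ‖ ^ 2 := by
  rcases n with _ | n
  · have : ∀ g, R.a g Φ = 0 := fun g => (Submodule.mem_bot ℂ).1 (R.a_mem_below g hΦ)
    simp [this]
  refine (R.norm_sum_a_sq_le s _ _).trans ?_
  have h1 := R.sum_norm_a_conj_sq_le hΦ he s
  have h2 : ∑ j ∈ s, ∑ k ∈ s, ‖R.a (B (e k)) (R.a (J.conj (e j)) Φ)‖ ^ 2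
      ≤ ∑ j ∈ s, ‖B‖ ^ 2 * (n * ‖R.a (J.conj (e j)) Φ‖ ^ 2) :=
    Finset.sum_le_sum fun j _ => R.sum_norm_a_sq_le (R.a_mem_below _ hΦ) he B s
  rw [← Finset.mul_sum, ← Finset.mul_sum] at h2
  have hH0 : 0 ≤ H := le_trans (by positivity) hH
  -- Here Φ has n + 1 particles and a(ē_j)Φ has n; n(n+1) = (n+1)² - (n+1) is the origin of the term
  -- -‖B‖².
  calc _ ≤ ‖B‖ ^ 2 * (n * ((n + 1 : ℕ) * ‖Φ‖ ^ 2)) + H * ((n + 1 : ℕ) * ‖Φ‖ ^ 2) := by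
        refine add_le_add (h2.trans ?_) ?_
        · gcongr
        · exact mul_le_mul hH h1 (by positivity) hH0
    _ = _ := by push_cast; ring

end FockRepresentation

/-! ### Orthogonal sums, Hilbert–Schmidt sums and the transpose -/

theorem norm_sum_sq_of_pairwise {E κ : Type*} [NormedAddCommGroup E] [InnerProductSpace ℂ E]
    (s : Finset κ) (x : κ → E) (h : ∀ j k, j ≠ k → inner ℂ (x j) (x k) = 0) :
    ‖∑ j ∈ s, x j‖ ^ 2 = ∑ j ∈ s, ‖x j‖ ^ 2 := by
  rw [← inner_self_eq_norm_sq (𝕜 := ℂ), sum_inner, map_sum]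
  refine Finset.sum_congr rfl fun j hj => ?_
  rw [inner_sum, Finset.sum_eq_single j (fun k _ hk => h j k hk.symm) (fun h => (h hj).elim),
    inner_self_eq_norm_sq]

theorem HilbertBasis.sum_norm_sq_le_hsNorm_sq {L : Type*} [NormedAddCommGroup L]
    [InnerProductSpace ℂ L] [CompleteSpace L] {ι : Type*} (e : HilbertBasis ι ℂ L)
    {A : L →L[ℂ] L} (hA : IsHilbertSchmidt A) (s : Finset ι) :
    ∑ j ∈ s, ‖A (e j)‖ ^ 2 ≤ hsNorm A ^ 2 := by
  rw [hsNorm, Real.sq_sqrt ENNReal.toReal_nonneg]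
  refine (ENNReal.ofReal_le_iff_le_toReal hA.ne).1 ?_
  rw [hsNormSq_eq e, ENNReal.ofReal_sum_of_nonneg fun _ _ => by positivity]
  refine le_trans (le_of_eq (Finset.sum_congr rfl fun j _ => ?_)) (ENNReal.sum_le_tsum s)
  rw [← ofReal_norm, ENNReal.ofReal_pow (norm_nonneg _)]

namespace Conjugation

variable {L : Type*} [NormedAddCommGroup L] [InnerProductSpace ℂ L] [CompleteSpace L]

set_option linter.unusedSectionVars false in
theorem conjOp_apply (J : Conjugation L) (A : L →L[ℂ] L) (f : L) :
    J.conjOp A f = J.conj (A (J.conj f)) := rfl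

/-- The image of a complete orthonormal system under the conjugation. -/
def mapHilbertBasis (J : Conjugation L) {ι : Type*} (e : HilbertBasis ι ℂ L) :
    HilbertBasis ι ℂ L :=
  HilbertBasis.mkOfOrthogonalEqBot (J.orthonormal_conj e.orthonormal) <| by
    refine (Submodule.eq_bot_iff _).2 fun x hx => ?_
    have h : ∀ i, inner ℂ (e i) (J.conj x) = 0 := fun i => by
      have h2 := Submodule.inner_right_of_mem_orthogonal
        (Submodule.subset_span (Set.mem_range_self i)) hx
      rw [← J.inner_conj_conj, J.conj_conj, ← inner_conj_symm, h2, map_zero]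
    have h3 : J.conj x = 0 := by
      refine e.repr.injective ?_
      ext i
      rw [e.repr_apply_apply, h, map_zero]
      rfl
    rw [← J.conj_conj x, h3, map_zero]

theorem mapHilbertBasis_apply (J : Conjugation L) {ι : Type*} (e : HilbertBasis ι ℂ L) (i : ι) :
    J.mapHilbertBasis e i = J.conj (e i) := by
  rw [mapHilbertBasis, HilbertBasis.coe_mkOfOrthogonalEqBot]

theorem hsNormSq_transpose (J : Conjugation L) (A : L →L[ℂ] L) :
    hsNormSq (J.transpose A) = hsNormSq A := by
  obtain ⟨w, b, -⟩ := exists_hilbertBasis ℂ L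
  have h : hsSum b (J.transpose A) = hsSum b (J.conjOp A) := (hsSum_adjoint b b _).symm
  rw [hsNormSq_eq b, hsNormSq_eq (J.mapHilbertBasis b)]
  refine h.trans (tsum_congr fun i => ?_)
  rw [conjOp_apply, mapHilbertBasis_apply, ← ofReal_norm, ← ofReal_norm, J.norm_conj]

/-- Aᵀ is the transpose for the symmetric bilinear form (f̄, g); this identity is behind Δ(Aᵀ) =
Δ(A). -/
theorem inner_conj_transpose (J : Conjugation L) (A : L →L[ℂ] L) (f g : L) :
    inner ℂ (J.conj f) (J.transpose A g) = inner ℂ (J.conj g) (A f) := by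
  rw [transpose, ContinuousLinearMap.adjoint_inner_right, conjOp_apply, J.conj_conj,
    J.inner_conj_left]

end Conjugation

/-! ### From single sectors to finitely many particles -/

namespace FockRepresentation

variable {L : Type*} [NormedAddCommGroup L] [InnerProductSpace ℂ L] {J : Conjugation L}
variable {F : Type*} [NormedAddCommGroup F] [InnerProductSpace ℂ F]

theorem inner_eq_zero_of_ne (R : FockRepresentation J F) {m n : ℕ} (h : m ≠ n) {Φ Ψ : R.dom}
    (hΦ : Φ ∈ R.nSpace m) (hΨ : Ψ ∈ R.nSpace n) : inner ℂ Φ Ψ = 0 := by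
  have hmem : ∀ {n} {Φ : R.dom}, Φ ∈ R.nSpace n → (Φ : F) ∈ R.sector n := fun h =>
    Submodule.le_topologicalClosure _ (R.sector₀_eq_map _ ▸ Submodule.mem_map_of_mem h)
  exact (R.sector_isOrtho h).inner_eq (hmem hΦ) (hmem hΨ)

/-- The operator `T` removes `r` particles. -/
def Removes (R : FockRepresentation J F) (r : ℕ) (T : R.dom →ₗ[ℂ] R.dom) : Prop :=
  ∀ n, ∀ Φ ∈ R.nSpace n, T Φ = 0 ∨ ∃ k, n = k + r ∧ T Φ ∈ R.nSpace k

theorem removes_a (R : FockRepresentation J F) (f : L) : R.Removes 1 (R.a f) :=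
  fun _ _ hΦ => R.below_eq_of_mem (R.a_mem_below f hΦ)

theorem removes_sum (R : FockRepresentation J F) {r : ℕ} {κ : Type*} (s : Finset κ)
    {T : κ → R.dom →ₗ[ℂ] R.dom} (h : ∀ j, R.Removes r (T j)) : R.Removes r (∑ j ∈ s, T j) := by
  intro n Φ hΦ
  rw [LinearMap.sum_apply]
  by_cases hn : ∃ k, n = k + r
  · obtain ⟨k, rfl⟩ := hn
    refine .inr ⟨k, rfl, Submodule.sum_mem _ fun j _ => ?_⟩
    obtain h | ⟨k', hk, h⟩ := h j _ Φ hΦ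
    · exact h ▸ Submodule.zero_mem _
    · obtain rfl : k = k' := by omega
      exact h
  · refine .inl (Finset.sum_eq_zero fun j _ => (h j _ Φ hΦ).resolve_right ?_)
    rintro ⟨k, hk, -⟩
    exact hn ⟨k, hk⟩

theorem removes_comp (R : FockRepresentation J F) {r q : ℕ} {S T : R.dom →ₗ[ℂ] R.dom}
    (hS : R.Removes r S) (hT : R.Removes q T) : R.Removes (r + q) (S ∘ₗ T) := by
  intro n Φ hΦ
  rw [LinearMap.comp_apply]
  obtain h | ⟨k, rfl, h⟩ := hT n Φ hΦ
  · exact .inl (by rw [h, map_zero])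
  obtain h' | ⟨k', rfl, h'⟩ := hS _ _ h
  · exact .inl h'
  · exact .inr ⟨k', by ring, h'⟩

/-- The operators `∑ a(B e_j) a(ē_j)`, summed over `s`, on the common domain. -/
def deltaSum (R : FockRepresentation J F) {κ : Type*} (e : κ → L) (B : L →L[ℂ] L)
    (s : Finset κ) : R.dom →ₗ[ℂ] R.dom :=
  ∑ j ∈ s, R.a (B (e j)) ∘ₗ R.a (J.conj (e j))

theorem deltaSum_apply (R : FockRepresentation J F) {κ : Type*} (e : κ → L) (B : L →L[ℂ] L)
    (s : Finset κ) (Φ : R.dom) :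
    R.deltaSum e B s Φ = ∑ j ∈ s, R.a (B (e j)) (R.a (J.conj (e j)) Φ) := by
  simp [deltaSum]

theorem removes_deltaSum (R : FockRepresentation J F) {κ : Type*} (e : κ → L) (B : L →L[ℂ] L)
    (s : Finset κ) : R.Removes 2 (R.deltaSum e B s) :=
  R.removes_sum s fun _ => R.removes_comp (R.removes_a _) (R.removes_a _)

/-- The map `Φ ↦ (Φ, N^{1/2} Φ, N Φ)` on the `n`-particle space. -/
def weightMap (F : Type*) [NormedAddCommGroup F] [InnerProductSpace ℂ F] (n : ℕ) :
    F →L[ℂ] F × F × F :=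
  (ContinuousLinearMap.id ℂ F).prod
    (((((n : ℝ) ^ (1 / 2 : ℝ) : ℝ) : ℂ) • ContinuousLinearMap.id ℂ F).prod
      ((((n : ℝ) ^ (1 : ℝ) : ℝ) : ℂ) • ContinuousLinearMap.id ℂ F))

/-- The triples `(Φ, N^{1/2} Φ, N Φ)` for algebraic vectors `Φ` with finitely many particles. -/
def weightGraph (R : FockRepresentation J F) : Submodule ℂ (F × F × F) :=
  ⨆ n, (R.sector₀ n).map (weightMap F n : F →ₗ[ℂ] F × F × F)

theorem mem_weightGraph (R : FockRepresentation J F) {u : F × F × F} (hu : u ∈ R.weightGraph) :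
    ∃ (s : Finset ℕ) (Ψ : ℕ → R.dom), (∀ n, Ψ n ∈ R.nSpace n) ∧
      u = ∑ n ∈ s, weightMap F n (Ψ n) := by
  obtain ⟨f, hf, rfl⟩ := (Submodule.mem_iSup_iff_exists_finsupp _ _).1 hu
  have : ∀ n, ∃ Ψ : R.dom, Ψ ∈ R.nSpace n ∧ weightMap F n Ψ = f n := fun n => by
    obtain ⟨x, hx, h⟩ := hf n
    rw [R.sector₀_eq_map] at hx
    obtain ⟨Ψ, hΨ, rfl⟩ := hx
    exact ⟨Ψ, hΨ, h⟩
  choose Ψ h1 h2 using this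
  refine ⟨f.support, Ψ, h1, ?_⟩
  simp only [h2]
  rfl

theorem fst_mem_dom (R : FockRepresentation J F) {u : F × F × F} (hu : u ∈ R.weightGraph) :
    u.1 ∈ R.dom := by
  obtain ⟨s, Ψ, -, rfl⟩ := R.mem_weightGraph hu
  rw [Prod.fst_sum]
  exact Submodule.sum_mem _ fun n _ => (Ψ n).2

/-- The triples form a subspace, so a bound on `T` applies to differences and yields Cauchy
estimates. -/
theorem norm_sq_sub_le (R : FockRepresentation J F) {T : R.dom →ₗ[ℂ] R.dom} {α β : ℝ}
    (hT : ∀ {X : R.dom} {y z : F}, ((X : F), y, z) ∈ R.weightGraph →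
      ‖T X‖ ^ 2 ≤ α * ‖z‖ ^ 2 + β * ‖y‖ ^ 2) {u v : F × F × F} (hu : u ∈ R.weightGraph)
    (hv : v ∈ R.weightGraph) :
    ‖(T ⟨u.1, R.fst_mem_dom hu⟩ : F) - T ⟨v.1, R.fst_mem_dom hv⟩‖ ^ 2
      ≤ α * ‖u.2.2 - v.2.2‖ ^ 2 + β * ‖u.2.1 - v.2.1‖ ^ 2 := by
  rw [← Submodule.coe_sub, ← map_sub]
  exact hT (Submodule.sub_mem _ hu hv)

/-- Removing a fixed number of particles keeps distinct sectors orthogonal, so Pythagoras adds up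
the sectorwise bounds. The weights n² and n become the squared norms of NΦ and N^{1/2}Φ. -/
theorem norm_sq_le_of_mem_weightGraph (R : FockRepresentation J F) {r : ℕ}
    {T : R.dom →ₗ[ℂ] R.dom} (hT : R.Removes r T) {α β : ℝ}
    (hb : ∀ n : ℕ, ∀ Φ ∈ R.nSpace n, ‖T Φ‖ ^ 2 ≤ (α * n ^ 2 + β * n) * ‖Φ‖ ^ 2)
    {X : R.dom} {y z : F} (hX : ((X : F), y, z) ∈ R.weightGraph) :
    ‖T X‖ ^ 2 ≤ α * ‖z‖ ^ 2 + β * ‖y‖ ^ 2 := by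
  obtain ⟨s, Ψ, hΨ, hu⟩ := R.mem_weightGraph hX
  have hXs : X = ∑ n ∈ s, Ψ n := by
    refine Subtype.ext ((congrArg Prod.fst hu).trans ?_)
    rw [Prod.fst_sum, AddSubmonoidClass.coe_finsetSum]
    rfl
  have hy : y = ∑ n ∈ s, (((n : ℝ) ^ (1 / 2 : ℝ) : ℝ) : ℂ) • (Ψ n : F) := by
    refine (congrArg (fun u : F × F × F => u.2.1) hu).trans ?_
    simp only [Prod.snd_sum, Prod.fst_sum]
    rfl
  have hz : z = ∑ n ∈ s, (((n : ℝ) ^ (1 : ℝ) : ℝ) : ℂ) • (Ψ n : F) := by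
    refine (congrArg (fun u : F × F × F => u.2.2) hu).trans ?_
    simp only [Prod.snd_sum]
    rfl
  have horth : ∀ m n, m ≠ n → inner ℂ (Ψ m : F) (Ψ n : F) = 0 := fun m n h =>
    R.inner_eq_zero_of_ne h (hΨ m) (hΨ n)
  have hpyth : ∀ γ : ℝ, ‖∑ n ∈ s, (((n : ℝ) ^ γ : ℝ) : ℂ) • (Ψ n : F)‖ ^ 2
      = ∑ n ∈ s, ((n : ℝ) ^ γ) ^ 2 * ‖Ψ n‖ ^ 2 := fun γ => by
    rw [norm_sum_sq_of_pairwise]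
    · refine Finset.sum_congr rfl fun n _ => ?_
      rw [norm_smul, mul_pow, Complex.norm_real, Real.norm_eq_abs, sq_abs]
      rfl
    · intro m n h
      rw [inner_smul_left, inner_smul_right, horth m n h, mul_zero, mul_zero]
  rw [hXs, map_sum, norm_sum_sq_of_pairwise, hy, hz, hpyth, hpyth, Finset.mul_sum,
    Finset.mul_sum, ← Finset.sum_add_distrib]
  · refine Finset.sum_le_sum fun n _ => (hb n _ (hΨ n)).trans_eq ?_
    have h1 : ((n : ℝ) ^ (1 / 2 : ℝ)) ^ 2 = n := by
      rw [← Real.sqrt_eq_rpow, Real.sq_sqrt n.cast_nonneg]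
    rw [h1, Real.rpow_one]
    ring
  · intro m n h
    obtain h1 | ⟨k, rfl, h1⟩ := hT m _ (hΨ m)
    · rw [h1, inner_zero_left]
    obtain h2 | ⟨l, rfl, h2⟩ := hT n _ (hΨ n)
    · rw [h2, inner_zero_right]
    exact R.inner_eq_zero_of_ne (fun h' => h (by rw [h'])) h1 h2

theorem norm_sq_a_le_of_mem [CompleteSpace L] (R : FockRepresentation J F) (f : L) {X : R.dom}
    {y z : F} (hX : ((X : F), y, z) ∈ R.weightGraph) :
    ‖R.a f X‖ ^ 2 ≤ 0 * ‖z‖ ^ 2 + ‖f‖ ^ 2 * ‖y‖ ^ 2 :=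
  R.norm_sq_le_of_mem_weightGraph (R.removes_a f)
    (fun n Φ hΦ => (R.norm_a_sq_le hΦ f).trans_eq (by ring)) hX

theorem norm_sq_a_a_le_of_mem [CompleteSpace L] (R : FockRepresentation J F) (f g : L)
    {X : R.dom} {y z : F} (hX : ((X : F), y, z) ∈ R.weightGraph) :
    ‖(R.a f ∘ₗ R.a g) X‖ ^ 2 ≤ (‖f‖ ^ 2 * ‖g‖ ^ 2) * ‖z‖ ^ 2 + 0 * ‖y‖ ^ 2 :=
  R.norm_sq_le_of_mem_weightGraph (R.removes_comp (R.removes_a f) (R.removes_a g))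
    (fun n Φ hΦ => (R.norm_a_a_sq_le hΦ f g).trans_eq (by ring)) hX

theorem norm_sq_deltaSum_le_of_mem [CompleteSpace L] (R : FockRepresentation J F)
    {B : L →L[ℂ] L} (hB : IsHilbertSchmidt B) {κ : Type*} (e : HilbertBasis κ ℂ L)
    (s : Finset κ) {X : R.dom} {y z : F} (hX : ((X : F), y, z) ∈ R.weightGraph) :
    ‖R.deltaSum e B s X‖ ^ 2 ≤ ‖B‖ ^ 2 * ‖z‖ ^ 2 + (hsNorm B ^ 2 - ‖B‖ ^ 2) * ‖y‖ ^ 2 :=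
  R.norm_sq_le_of_mem_weightGraph (R.removes_deltaSum e B s) (fun n Φ hΦ => by
    rw [deltaSum_apply]
    exact R.norm_sum_a_a_sq_le hΦ e.orthonormal B s (e.sum_norm_sq_le_hsNorm_sq hB s)) hX

/-- On algebraic vectors with `n` particles, `Δ_M(A)` and `Δ_M(Aᵀ)` converge to a limit that does
not depend on the complete orthonormal system. -/
theorem exists_tendsto_deltaSum_nSpace [CompleteSpace L] (R : FockRepresentation J F)
    (A : L →L[ℂ] L) {n : ℕ} {Φ : R.dom} (hΦ : Φ ∈ R.nSpace n) :
    ∃ ℓ : R.dom, ∀ B : L →L[ℂ] L, B = A ∨ B = J.transpose A → ∀ e : HilbertBasis ℕ ℂ L,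
      Tendsto (fun M => R.deltaSum e B (Finset.range M) Φ) atTop (𝓝 ℓ) := by
  rcases n with _ | n
  · refine ⟨0, fun B _ e => ?_⟩
    have : ∀ g, R.a g Φ = 0 := fun g => (Submodule.mem_bot ℂ).1 (R.a_mem_below g hΦ)
    simp only [deltaSum_apply, this, map_zero, Finset.sum_const_zero]
    exact tendsto_const_nhds
  obtain ⟨ι, _, h, v, h1, h2, -⟩ := R.exists_a_eq_sum hΦ
  have := fun i => R.exists_a_eq_sum (h1 i)
  choose κ _ k w _ h3 _ using this
  have haa : ∀ f g, R.a f (R.a g Φ)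
      = ∑ i, ∑ l, (inner ℂ (J.conj g) (h i) * inner ℂ (J.conj f) (k i l)) • w i l := fun f g => by
    rw [h2, map_sum]
    refine Finset.sum_congr rfl fun i _ => ?_
    rw [map_smul, h3, Finset.smul_sum]
    simp only [smul_smul]
  have hadj : ∀ (B : L →L[ℂ] L) f g, inner ℂ (J.conj (B f)) g
      = inner ℂ (ContinuousLinearMap.adjoint B (J.conj g)) f := fun B f g => by
    rw [ContinuousLinearMap.adjoint_inner_left, J.inner_conj_left]
  -- Parseval: ∑_j (B*k̄, e_j)(e_j, h) = (k̄, B h).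
  refine ⟨∑ i, ∑ l, inner ℂ (J.conj (k i l)) (A (h i)) • w i l, ?_⟩
  rintro B (rfl | rfl) e
  · simp only [deltaSum_apply, haa, J.conj_conj, hadj]
    refine (hasSum_sum fun i _ => hasSum_sum fun l _ => ?_ : HasSum _ _).tendsto_sum_nat
    refine HasSum.smul_const ?_ _
    rw [← ContinuousLinearMap.adjoint_inner_left]
    simpa only [mul_comm] using
      e.hasSum_inner_mul_inner (ContinuousLinearMap.adjoint B (J.conj (k i l))) (h i)
  -- With the annihilators exchanged, Parseval gives (h̄, Aᵀk) = (k̄, A h), the same coefficients.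
  · have hcomm : ∀ f g, R.a f (R.a g Φ) = R.a g (R.a f Φ) := fun f g =>
      sub_eq_zero.1 (R.a_comm f g Φ)
    simp only [deltaSum_apply, hcomm (J.transpose A _), haa, J.conj_conj, hadj]
    refine (hasSum_sum fun i _ => hasSum_sum fun l _ => ?_ : HasSum _ _).tendsto_sum_nat
    refine HasSum.smul_const ?_ _
    rw [← J.inner_conj_transpose, ← ContinuousLinearMap.adjoint_inner_left]
    exact e.hasSum_inner_mul_inner _ _

theorem exists_tendsto_deltaSum_of_mem [CompleteSpace L] (R : FockRepresentation J F)
    (A : L →L[ℂ] L) {u : F × F × F} (hu : u ∈ R.weightGraph) :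
    ∃ ℓ : F, ∀ B : L →L[ℂ] L, B = A ∨ B = J.transpose A → ∀ e : HilbertBasis ℕ ℂ L,
      Tendsto (fun M => (R.deltaSum e B (Finset.range M) ⟨u.1, R.fst_mem_dom hu⟩ : F)) atTop
        (𝓝 ℓ) := by
  obtain ⟨s, Ψ, hΨ, hu'⟩ := R.mem_weightGraph hu
  choose ℓ hℓ using fun n => R.exists_tendsto_deltaSum_nSpace A (hΨ n)
  refine ⟨((∑ n ∈ s, ℓ n : R.dom) : F), fun B hB e => ?_⟩
  have hXs : (⟨u.1, R.fst_mem_dom hu⟩ : R.dom) = ∑ n ∈ s, Ψ n := by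
    refine Subtype.ext ((congrArg Prod.fst hu').trans ?_)
    rw [Prod.fst_sum, AddSubmonoidClass.coe_finsetSum]
    rfl
  rw [hXs]
  simp only [map_sum]
  exact (continuous_subtype_val.tendsto _).comp
    (tendsto_finsetSum s fun n _ => hℓ n B hB e)

end FockRepresentation

/-! ### A sequential orthonormal basis and limit lemmas -/

/-- Balls of radius 1/2 about the basis vectors are disjoint, so separability makes the basis
countable. One reference system is needed to read off the bound and the linearity of Δ(A). -/
theorem exists_hilbertBasis_nat {L : Type*} [NormedAddCommGroup L] [InnerProductSpace ℂ L]
    [CompleteSpace L] [TopologicalSpace.SeparableSpace L] (hL : ¬ FiniteDimensional ℂ L) :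
    Nonempty (HilbertBasis ℕ ℂ L) := by
  obtain ⟨w, b, -⟩ := exists_hilbertBasis ℂ L
  have hdist : ∀ i j, i ≠ j → 1 ≤ dist (b i) (b j) := fun i j h => by
    have h2 := norm_sub_sq (𝕜 := ℂ) (b i) (b j)
    rw [b.orthonormal.2 h, b.orthonormal.1, b.orthonormal.1] at h2
    rw [dist_eq_norm]
    simp only [map_zero, mul_zero, sub_zero] at h2
    nlinarith [norm_nonneg (b i - b j)]
  have hcount : Countable w := by
    refine Pairwise.countable_of_isOpen_disjoint (s := fun i => Metric.ball (b i) (1 / 2))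
      (fun i j h => Metric.ball_disjoint_ball (by linarith [hdist i j h]))
      (fun i => Metric.isOpen_ball) fun i => ⟨b i, Metric.mem_ball_self (by norm_num)⟩
  have hinf : Infinite w := by
    rw [← not_finite_iff_infinite]
    intro h
    have := Fintype.ofFinite w
    exact hL b.toOrthonormalBasis.toBasis.finiteDimensional_of_finite
  obtain ⟨φ⟩ := nonempty_equiv_of_countable (α := ℕ) (β := w)
  refine ⟨HilbertBasis.mkOfOrthogonalEqBot (b.orthonormal.comp φ φ.injective) ?_⟩
  rw [φ.surjective.range_comp, ← Submodule.orthogonal_closure, b.dense_span,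
    Submodule.top_orthogonal_eq_bot]

theorem tendsto_mul_norm_sq_add {F ι : Type*} [NormedAddCommGroup F] {l : Filter ι} (α β : ℝ)
    {y z : ι → F} {y₀ z₀ : F} (hy : Tendsto y l (𝓝 y₀)) (hz : Tendsto z l (𝓝 z₀)) :
    Tendsto (fun i => α * ‖z i‖ ^ 2 + β * ‖y i‖ ^ 2) l (𝓝 (α * ‖z₀‖ ^ 2 + β * ‖y₀‖ ^ 2)) :=
  ((hz.norm.pow 2).const_mul α).add ((hy.norm.pow 2).const_mul β)

theorem cauchySeq_of_norm_sq_sub_le {F : Type*} [NormedAddCommGroup F] {u y z : ℕ → F} {y₀ z₀ : F}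
    {α β : ℝ} (hy : Tendsto y atTop (𝓝 y₀)) (hz : Tendsto z atTop (𝓝 z₀))
    (hu : ∀ k l, ‖u k - u l‖ ^ 2 ≤ α * ‖z k - z l‖ ^ 2 + β * ‖y k - y l‖ ^ 2) : CauchySeq u := by
  rw [cauchySeq_iff_tendsto_dist_atTop_0]
  have h1 : Tendsto (fun n : ℕ × ℕ => y n.1 - y n.2) atTop (𝓝 (y₀ - y₀)) := by
    rw [← prod_atTop_atTop_eq]
    exact (hy.comp tendsto_fst).sub (hy.comp tendsto_snd)
  have h2 : Tendsto (fun n : ℕ × ℕ => z n.1 - z n.2) atTop (𝓝 (z₀ - z₀)) := by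
    rw [← prod_atTop_atTop_eq]
    exact (hz.comp tendsto_fst).sub (hz.comp tendsto_snd)
  -- No sign of α or β is required, so ‖A‖ ≤ ‖A‖₂ is never needed.
  have h3 := (tendsto_mul_norm_sq_add α β h1 h2).sqrt
  simp only [sub_self, norm_zero, zero_pow two_ne_zero, mul_zero, add_zero, Real.sqrt_zero] at h3
  refine squeeze_zero (fun _ => dist_nonneg) (fun n => ?_) h3
  rw [dist_eq_norm]
  exact Real.le_sqrt_of_sq_le (hu _ _)

/-- Exchange of limits for a double sequence that is equicontinuous in its first index. -/
theorem tendsto_of_norm_sq_sub_le {F : Type*} [NormedAddCommGroup F] {u : ℕ → ℕ → F}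
    {w ℓs y z : ℕ → F} {ℓ y₀ z₀ : F} {α β : ℝ}
    (hy : Tendsto y atTop (𝓝 y₀)) (hz : Tendsto z atTop (𝓝 z₀))
    (hu : ∀ k l M, ‖u k M - u l M‖ ^ 2 ≤ α * ‖z k - z l‖ ^ 2 + β * ‖y k - y l‖ ^ 2)
    (hw : ∀ M, Tendsto (fun k => u k M) atTop (𝓝 (w M)))
    (hl : ∀ k, Tendsto (u k) atTop (𝓝 (ℓs k))) (h : Tendsto ℓs atTop (𝓝 ℓ)) :
    Tendsto w atTop (𝓝 ℓ) := by
  refine TendstoUniformly.tendsto_of_eventually_tendsto (F := u) ?_ (.of_forall hl) h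
  -- Letting l → ∞ in `hu` gives a bound uniform in M.
  have hle : ∀ k M, ‖u k M - w M‖ ^ 2 ≤ α * ‖z k - z₀‖ ^ 2 + β * ‖y k - y₀‖ ^ 2 := fun k M =>
    le_of_tendsto_of_tendsto' (((hw M).const_sub (u k M)).norm.pow 2)
      (tendsto_mul_norm_sq_add α β (hy.const_sub (y k)) (hz.const_sub (z k)))
      fun l => hu k l M
  have h3 := (tendsto_mul_norm_sq_add α β (hy.sub_const y₀) (hz.sub_const z₀)).sqrt
  simp only [sub_self, norm_zero, zero_pow two_ne_zero, mul_zero, add_zero, Real.sqrt_zero] at h3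
  rw [Metric.tendstoUniformly_iff]
  intro ε hε
  filter_upwards [h3.eventually (gt_mem_nhds hε)] with k hk M
  rw [dist_comm, dist_eq_norm]
  exact (Real.le_sqrt_of_sq_le (hle k M)).trans_lt hk

/-! ### Extension to D_1 -/

namespace FockRepresentation

variable {L : Type*} [NormedAddCommGroup L] [InnerProductSpace ℂ L] {J : Conjugation L}
variable {F : Type*} [NormedAddCommGroup F] [InnerProductSpace ℂ F] [CompleteSpace F]

theorem D_mono (R : FockRepresentation J F) {α β : ℝ} (h : α ≤ β) : R.D β ≤ R.D α := by
  intro Φ hΦ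
  refine Summable.of_nonneg_of_le (fun n => by positivity) (fun n => ?_) hΦ
  refine mul_le_mul_of_nonneg_right ?_ (by positivity)
  exact Real.rpow_le_rpow_of_exponent_le (by linarith [n.cast_nonneg (α := ℝ)]) (by linarith)

theorem component_mem (R : FockRepresentation J F) (n : ℕ) (Φ : F) :
    R.component n Φ ∈ R.sector n := by
  have : CompleteSpace (R.sector n) :=
    inferInstanceAs (CompleteSpace (R.sector₀ n).topologicalClosure)
  exact Submodule.starProjection_apply_mem _ _

theorem inner_component (R : FockRepresentation J F) {n : ℕ} (Φ : F) {Ψ : F}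
    (hΨ : Ψ ∈ R.sector n) : inner ℂ Ψ (R.component n Φ) = inner ℂ Ψ Φ := by
  have : CompleteSpace (R.sector n) :=
    inferInstanceAs (CompleteSpace (R.sector₀ n).topologicalClosure)
  have h := Submodule.inner_right_of_mem_orthogonal hΨ
    (Submodule.sub_starProjection_mem_orthogonal (K := R.sector n) Φ)
  rw [inner_sub_right, sub_eq_zero] at h
  exact h.symm

/-- The difference between Φ and the sum of its components is orthogonal to all monomials, hence
zero by cyclicity. -/
theorem hasSum_component (R : FockRepresentation J F) {Φ : F} (hΦ : Φ ∈ R.D 0) :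
    HasSum (fun n => R.component n Φ) Φ := by
  have h := R.hasSum_numberPow le_rfl hΦ
  -- Since 0 ^ 0 = 1, the vacuum component is kept.
  simp only [Real.rpow_zero, one_smul] at h
  suffices hx : Φ - R.numberPow 0 Φ = 0 by rwa [← sub_eq_zero.1 hx] at h
  refine R.cyclic.eq_zero_of_inner_left ℂ fun Ψ hΨ => ?_
  induction hΨ using Submodule.span_induction with
  | zero => exact inner_zero_right _
  | add x y _ _ hx hy =>
    rw [inner_add_right]
    simp_all
  | smul c x _ hx => rw [inner_smul_right]; simp_all
  | mem x hx =>
    obtain ⟨l, rfl⟩ := hx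
    have hmem : (R.monomial l : F) ∈ R.sector l.length :=
      Submodule.le_topologicalClosure _ (Submodule.subset_span ⟨l, rfl, rfl⟩)
    have h2 := h.mapL (innerSL ℂ (R.monomial l : F))
    simp only [innerSL_apply_apply] at h2
    have h3 := h2.unique (hasSum_single l.length fun m hm =>
      (R.sector_isOrtho hm.symm).inner_eq hmem (R.component_mem m Φ))
    rw [R.inner_component Φ hmem] at h3
    rw [← inner_conj_symm, inner_sub_right]
    change starRingEnd ℂ (inner ℂ (R.monomial l : F) Φ - inner ℂ (R.monomial l : F) _) = 0
    rw [h3, sub_self, map_zero]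

/-- Vectors in `D_1` are approximated by algebraic vectors, together with the actions of `N^{1/2}`
and `N` on them. -/
theorem mem_closure_weightGraph (R : FockRepresentation J F) {Φ : F} (hΦ : Φ ∈ R.D 1) :
    (Φ, R.numberPow (1 / 2) Φ, R.numberPow 1 Φ) ∈ closure (R.weightGraph : Set (F × F × F)) := by
  have h := (R.hasSum_component (R.D_mono zero_le_one hΦ)).prodMk
    ((R.hasSum_numberPow (by norm_num) (R.D_mono (by norm_num : (1 / 2 : ℝ) ≤ 1) hΦ)).prodMk
      (R.hasSum_numberPow zero_le_one hΦ))
  rw [← Submodule.topologicalClosure_coe]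
  refine Submodule.isClosed_topologicalClosure _ |>.mem_of_tendsto h (.of_forall fun s => ?_)
  refine Submodule.sum_mem _ fun n _ => ?_
  -- The component lies only in the closed sector; continuity of the weight map sends it into the
  -- closure.
  have hw : weightMap F n (R.component n Φ) ∈ closure (R.weightGraph : Set (F × F × F)) := by
    refine map_mem_closure (weightMap F n).continuous (R.component_mem n Φ) fun x hx => ?_
    exact Submodule.mem_iSup_of_mem n (Submodule.mem_map_of_mem hx)
  rw [← SetLike.mem_coe, Submodule.topologicalClosure_coe]
  convert hw using 1
  exact Prod.ext rfl (Prod.ext (Complex.coe_smul _ _).symm (Complex.coe_smul _ _).symm)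

theorem exists_seq_weightGraph (R : FockRepresentation J F) {Φ : F} (hΦ : Φ ∈ R.D 1) :
    ∃ u : ℕ → F × F × F, (∀ k, u k ∈ R.weightGraph) ∧ Tendsto (fun k => (u k).1) atTop (𝓝 Φ) ∧
      Tendsto (fun k => (u k).2.1) atTop (𝓝 (R.numberPow (1 / 2) Φ)) ∧
      Tendsto (fun k => (u k).2.2) atTop (𝓝 (R.numberPow 1 Φ)) := by
  obtain ⟨u, hu, h⟩ := mem_closure_iff_seq_limit.1 (R.mem_closure_weightGraph hΦ)
  exact ⟨u, hu, h.fst_nhds, h.snd_nhds.fst_nhds, h.snd_nhds.snd_nhds⟩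

theorem ann_of_tendsto (R : FockRepresentation J F) (f : L) {X : ℕ → R.dom} {Φ Ψ : F}
    (h1 : Tendsto (fun k => (X k : F)) atTop (𝓝 Φ))
    (h2 : Tendsto (fun k => (R.a f (X k) : F)) atTop (𝓝 Ψ)) :
    ∃ h : Φ ∈ (R.ann f).domain, R.ann f ⟨Φ, h⟩ = Ψ := by
  have h : (Φ, Ψ) ∈ (R.ann₀ f).graph.topologicalClosure := by
    refine mem_closure_of_tendsto (h1.prodMk_nhds h2) (.of_forall fun k => ?_)
    exact (R.ann₀ f).mem_graph (X k)
  rw [(R.ann₀_isClosable f).graph_closure_eq_closure_graph, LinearPMap.mem_graph_iff] at h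
  obtain ⟨y, rfl, h⟩ := h
  exact ⟨y.2, h⟩

variable [CompleteSpace L]

/-- Along the approximating sequence both a(g) and a(f)a(g) give Cauchy sequences; closedness, used
once for each factor, puts Φ in the natural domain of the product. -/
theorem mulOp_ann_tendsto (R : FockRepresentation J F) (f g : L) {u : ℕ → F × F × F}
    (hu : ∀ k, u k ∈ R.weightGraph) {Φ y z : F} (h1 : Tendsto (fun k => (u k).1) atTop (𝓝 Φ))
    (h2 : Tendsto (fun k => (u k).2.1) atTop (𝓝 y))
    (h3 : Tendsto (fun k => (u k).2.2) atTop (𝓝 z)) :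
    ∃ h : Φ ∈ ((R.ann f).mulOp (R.ann g)).domain,
      Tendsto (fun k => (R.a f (R.a g ⟨(u k).1, R.fst_mem_dom (hu k)⟩) : F)) atTop
        (𝓝 ((R.ann f).mulOp (R.ann g) ⟨Φ, h⟩)) := by
  have hX : Tendsto (fun k => ((⟨(u k).1, R.fst_mem_dom (hu k)⟩ : R.dom) : F)) atTop (𝓝 Φ) := h1
  obtain ⟨Ψ, hΨ⟩ := cauchySeq_tendsto_of_complete <| cauchySeq_of_norm_sq_sub_le h2 h3 fun k l =>
    R.norm_sq_sub_le (R.norm_sq_a_le_of_mem g) (hu k) (hu l)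
  obtain ⟨Ξ, hΞ⟩ := cauchySeq_tendsto_of_complete <| cauchySeq_of_norm_sq_sub_le h2 h3 fun k l =>
    R.norm_sq_sub_le (R.norm_sq_a_a_le_of_mem f g) (hu k) (hu l)
  obtain ⟨h4, rfl⟩ := R.ann_of_tendsto g hX hΨ
  obtain ⟨h5, rfl⟩ := R.ann_of_tendsto f hΨ hΞ
  exact ⟨LinearPMap.mem_mulOp_domain.2 ⟨h4, h5⟩, hΞ⟩

theorem deltaPartial_tendsto (R : FockRepresentation J F) (e : HilbertBasis ℕ ℂ L)
    (B : L →L[ℂ] L) (M : ℕ) {u : ℕ → F × F × F}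
    (hu : ∀ k, u k ∈ R.weightGraph) {Φ y z : F} (h1 : Tendsto (fun k => (u k).1) atTop (𝓝 Φ))
    (h2 : Tendsto (fun k => (u k).2.1) atTop (𝓝 y))
    (h3 : Tendsto (fun k => (u k).2.2) atTop (𝓝 z)) :
    ∃ h : Φ ∈ (R.deltaPartial e B M).domain,
      Tendsto (fun k => (R.deltaSum e B (Finset.range M) ⟨(u k).1, R.fst_mem_dom (hu k)⟩ : F))
        atTop (𝓝 (R.deltaPartial e B M ⟨Φ, h⟩)) := by
  induction M with
  | zero =>
    -- The empty sum is the zero operator with full domain.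
    refine ⟨Submodule.mem_top, ?_⟩
    simp only [deltaSum_apply, Finset.range_zero, Finset.sum_empty]
    exact tendsto_const_nhds
  | succ M ih =>
    obtain ⟨h4, h5⟩ := ih
    obtain ⟨h6, h7⟩ := R.mulOp_ann_tendsto (B (e M)) (J.conj (e M)) hu h1 h2 h3
    have hM : R.deltaPartial e B (M + 1)
        = R.deltaPartial e B M + (R.ann (B (e M))).mulOp (R.ann (J.conj (e M))) :=
      Finset.sum_range_succ _ _
    rw [hM]
    refine ⟨⟨h4, h6⟩, ?_⟩
    simp only [deltaSum_apply, Finset.sum_range_succ, Submodule.coe_add] at h5 ⊢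
    exact h5.add h7

/-- Pointwise existence of `Δ(A) Φ`, together with its norm bound. -/
theorem exists_delta_apply [TopologicalSpace.SeparableSpace L] (hL : ¬ FiniteDimensional ℂ L)
    (R : FockRepresentation J F) {A : L →L[ℂ] L} (hA : IsHilbertSchmidt A) {Φ : F}
    (hΦ : Φ ∈ R.D 1) :
    ∃ ℓ : F, ‖ℓ‖ ^ 2 ≤ ‖A‖ ^ 2 * ‖R.numberPow 1 Φ‖ ^ 2
        + (hsNorm A ^ 2 - ‖A‖ ^ 2) * ‖R.numberPow (1 / 2) Φ‖ ^ 2 ∧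
      ∀ B : L →L[ℂ] L, B = A ∨ B = J.transpose A → ∀ e : HilbertBasis ℕ ℂ L,
        ∃ h : ∀ M, Φ ∈ (R.deltaPartial e B M).domain,
          Tendsto (fun M => R.deltaPartial e B M ⟨Φ, h M⟩) atTop (𝓝 ℓ) := by
  obtain ⟨e₀⟩ := exists_hilbertBasis_nat hL
  obtain ⟨u, hu, h1, h2, h3⟩ := R.exists_seq_weightGraph hΦ
  choose ℓs hℓs using fun k => R.exists_tendsto_deltaSum_of_mem A (hu k)
  have hdiff : ∀ k l, ‖ℓs k - ℓs l‖ ^ 2 ≤ ‖A‖ ^ 2 * ‖(u k).2.2 - (u l).2.2‖ ^ 2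
      + (hsNorm A ^ 2 - ‖A‖ ^ 2) * ‖(u k).2.1 - (u l).2.1‖ ^ 2 := fun k l =>
    le_of_tendsto' (((hℓs k A (.inl rfl) e₀).sub (hℓs l A (.inl rfl) e₀)).norm.pow 2) fun M =>
      R.norm_sq_sub_le (R.norm_sq_deltaSum_le_of_mem hA e₀ (Finset.range M)) (hu k) (hu l)
  have hbound : ∀ k, ‖ℓs k‖ ^ 2 ≤ ‖A‖ ^ 2 * ‖(u k).2.2‖ ^ 2
      + (hsNorm A ^ 2 - ‖A‖ ^ 2) * ‖(u k).2.1‖ ^ 2 := fun k =>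
    le_of_tendsto' ((hℓs k A (.inl rfl) e₀).norm.pow 2) fun M =>
      R.norm_sq_deltaSum_le_of_mem hA e₀ (Finset.range M) (hu k)
  obtain ⟨ℓ, hℓ⟩ := cauchySeq_tendsto_of_complete (cauchySeq_of_norm_sq_sub_le h2 h3 hdiff)
  refine ⟨ℓ, le_of_tendsto_of_tendsto' (hℓ.norm.pow 2) (tendsto_mul_norm_sq_add _ _ h2 h3) hbound,
    fun B hB e => ?_⟩
  have hB2 : IsHilbertSchmidt B := by
    rcases hB with rfl | rfl
    · exact hA
    · exact (J.hsNormSq_transpose A).trans_lt hA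
  choose hdom hlim using fun M => R.deltaPartial_tendsto e B M hu h1 h2 h3
  -- The limits `ℓs k` are common to A, Aᵀ and all systems, so only equicontinuity in M, with the
  -- constants of `B` itself, is needed to exchange limits.
  exact ⟨hdom, tendsto_of_norm_sq_sub_le h2 h3
    (fun k l M => R.norm_sq_sub_le (R.norm_sq_deltaSum_le_of_mem hB2 e (Finset.range M))
      (hu k) (hu l)) hlim (fun k => hℓs k B hB e) hℓ⟩

end FockRepresentation

end

theorem theorem6 {L : Type*} [NormedAddCommGroup L] [InnerProductSpace ℂ L] [CompleteSpace L]
    [TopologicalSpace.SeparableSpace L] (hL : ¬ FiniteDimensional ℂ L) (J : Conjugation L)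
    {F : Type*} [NormedAddCommGroup F] [InnerProductSpace ℂ F] [CompleteSpace F]
    (R : FockRepresentation J F) (A : L →L[ℂ] L) (hA : IsHilbertSchmidt A) :
    ∃ Δ : R.D 1 →ₗ[ℂ] F,
      R.IsDelta A Δ ∧
      (∀ Φ : R.D 1, ‖Δ Φ‖ ^ 2 ≤ ‖A‖ ^ 2 * ‖R.numberPow 1 Φ‖ ^ 2
        + (hsNorm A ^ 2 - ‖A‖ ^ 2) * ‖R.numberPow (1 / 2) Φ‖ ^ 2) ∧
      R.IsDelta (J.transpose A) Δ := by
  obtain ⟨e₀⟩ := exists_hilbertBasis_nat hL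
  choose Δ hbound hlim using fun Φ : R.D 1 => R.exists_delta_apply hL hA Φ.2
  choose hdom₀ hlim₀ using fun Φ => hlim Φ A (.inl rfl) e₀
  refine ⟨{ toFun := Δ, map_add' := fun Φ Ψ => ?_, map_smul' := fun c Φ => ?_ }, ?_, hbound, ?_⟩
  -- Linearity passes to the limit along the single system `e₀`.
  · refine tendsto_nhds_unique (hlim₀ (Φ + Ψ)) (((hlim₀ Φ).add (hlim₀ Ψ)).congr fun M => ?_)
    exact ((R.deltaPartial e₀ A M).map_add _ _).symm
  · refine tendsto_nhds_unique (hlim₀ (c • Φ)) (((hlim₀ Φ).const_smul c).congr fun M => ?_)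
    exact ((R.deltaPartial e₀ A M).map_smul c _).symm
  · intro e
    choose hdom h using fun Φ => hlim Φ A (.inl rfl) e
    exact ⟨fun M Φ hΦ => hdom ⟨Φ, hΦ⟩ M, h⟩
  · intro e
    choose hdom h using fun Φ => hlim Φ (J.transpose A) (.inr rfl) e
    exact ⟨fun M Φ hΦ => hdom ⟨Φ, hΦ⟩ M, h⟩
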